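/- There is an absolute constant $C$ such that for every integer $n\ge 1$ there are integers $t\ge 0$ and $L=\lceil\lg n\rceil+t$ (where $\lg=\log_2$) with $$\Bigl|\,t-\Bigl(\frac n4-\lg n\Bigr)\Bigr|\le C\qquad\text{and}\qquad \Bigl|\,L-\frac n4\Bigr|\le C$$ for which the family ${\cal B}_n$ of all bipartite graphs on the vertex set $[n]=\{0,1,\dots,n-1\}$ admits an $L$-bit adjacency labeling scheme, that is, a pair of functions $$\mathit{Label}:{\cal B}_n\to\bigl([n]\to\{0,1\}^L\bigr),\qquad \mathit{Edge}:\{0,1\}^L\times\{0,1\}^L\to\{0,1\},$$ with $\mathit{Edge}$ symmetric, such that for every $G\in{\cal B}_n$ and all $u,v\in[n]$, the vertices $u$ and $v$ are adjacent in $G$ if and only if $\mathit{Edge}(\mathit{Label}(G)(u),\mathit{Label}(G)(v))=1$. Moreover, the label of each vertex is composed of a distinct index and a tag: for every $G\in{\cal B}_n$ there are an injective map $\mathit{ind}_G:[n]\to[n]$ and a map $\mathit{tag}_G:[n]\to\{0,1\}^t$ such that, for every vertex $u$, $\mathit{Label}(G)(u)$ is the concatenation of the $\lceil\lg n\rceil$-bit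 binary representation of $\mathit{ind}_G(u)$ and of $\mathit{tag}_G(u)$. In short: $n$-vertex bipartite graphs admit an adjacency labeling scheme with $(\frac n4+O(1))$-bit labels, each composed of a distinct index from $[n]$ and an $(\frac n4-\lg n+O(1))$-bit tag. -/

import Mathlib

/-- Bit strings of length `L`, i.e. `{0,1}^L`. -/
abbrev Bits (L : ℕ) : Type := Fin L → Bool

/-- An `L`-bit adjacency labeling scheme for a family `F` of undirected graphs on the vertex set
`[n] = {0, …, n-1}`: an encoder `label`, which sees the whole graph, and a symmetric decoder `edge`,
which sees only two labels and depends only on the family (not on the particular graph). -/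
structure AdjacencyLabelingScheme {n : ℕ} (F : Set (SimpleGraph (Fin n))) (L : ℕ) where
  label : F → Fin n → Bits L
  edge : Bits L → Bits L → Bool
  edge_comm : ∀ x y : Bits L, edge x y = edge y x
  adj_iff : ∀ (G : F) (u v : Fin n),
    (G : SimpleGraph (Fin n)).Adj u v ↔ edge (label G u) (label G v) = true

/-- The family of all bipartite graphs on the vertex set `[n]`. -/
def bipartiteGraphs (n : ℕ) : Set (SimpleGraph (Fin n)) :=
  {G | G.IsBipartite}

/-- The `b`-bit binary representation of `i` (least significant bit first), for `i < 2 ^ b`. -/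
def binaryEncoding (b i : ℕ) : Bits b :=
  fun j => i.testBit j

/-! A bipartite graph with sides of sizes a + b = n is an a × b matrix. Indexing one side from 0
upwards and the other from n - 1 downwards keeps indices distinct; one tag bit names the side. Let
the decoder compute entry (i, j) as a fixed 𝔽₂-linear function of the two tags. One choice of
coefficients serves all corners if no nonempty set of cells in a corner is annihilated by all of
them. Random coefficients achieve this by a union bound, provided the lines of each rectangle R × C
have more tag bits than the rectangle has cells, with a margin (`exists_universal_coeffs`). As
|R||C| ≤ (|R| + |C|) n/4, tags of n/4 + O(1) bits suffice.

The remaining lg n bits come from ordering each side. Let K = ⌈lg n⌉ - 11 and call the first 2K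
positions of a side special. The ordinary positions of each parity are sorted lexicographically by
their entries on the K opposite special lines of that parity. On them, the special line of level l
shows the parities of a monotone sequence with values below 2^(l+1), which is cheap to store
(`exists_parity_decoder`, `exists_sorting_perm`). These cells leave the linear system.

The parity split balances the budget. With K special lines serving all ordinary ones, about as many
cells would be freed, but the rectangle of ordinary lines would be too dense. As it is, tags of n/4
- K + O(1) bits suffice (`rectangle_budget`), and `exists_matrix_scheme` assembles the scheme. -/

/-! ### Random linear coefficients over 𝔽₂ -/

open Finset in
theorem two_mul_card_filter_sum_eq_zero_le {X : Type*} [Fintype X] [DecidableEq X]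
    (S : Finset X) (hS : S.Nonempty) :
    2 * #{v : X → ZMod 2 | ∑ x ∈ S, v x = 0} ≤ 2 ^ Fintype.card X := by
  obtain ⟨x₀, hx₀⟩ := hS
  have h1 : #{v : X → ZMod 2 | ∑ x ∈ S, v x = 0} ≤ #{v : X → ZMod 2 | ¬ ∑ x ∈ S, v x = 0} := by
    -- Adding 1 at a coordinate in `S` flips the sum.
    refine card_le_card_of_injOn (fun v => v + Pi.single x₀ 1) ?_ ?_
    · intro v hv
      simp only [coe_filter, mem_univ, true_and, Set.mem_ofPred_eq] at hv ⊢
      simp [Finset.sum_add_distrib, hv, Finset.sum_pi_single', hx₀]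
    · intro v _ v' _ h
      simpa using h
  have h2 := card_filter_add_card_filter_not (s := (univ : Finset (X → ZMod 2)))
    (fun v : X → ZMod 2 => ∑ x ∈ S, v x = 0)
  have h3 : #(univ : Finset (X → ZMod 2)) = 2 ^ Fintype.card X := by
    simp [Finset.card_univ, ZMod.card]
  omega

-- Union bound: for uniform `ω`, the sums attached to lines meeting `Y` vanish independently, each
-- with probability at most 1/2, so the term of `Y` bounds the probability that `Y` is not
-- separated.
open Finset in
open scoped Classical in
theorem exists_coeffs_separating {X W : Type*} [Fintype X] [Fintype W]
    (inc : W → X → Prop) (m : W → ℕ) (𝒴 : Finset (Finset X))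
    (h : ∑ Y ∈ 𝒴, ∏ w with ∃ x ∈ Y, inc w x, (1 / 2 : ℝ) ^ m w < 1) :
    ∃ ω : ∀ w, Fin (m w) → X → ZMod 2, ∀ Y ∈ 𝒴, ∃ w s, ∑ x ∈ Y with inc w x, ω w s x ≠ 0 := by
  by_contra! hcon
  set bad : Finset X → Finset (∀ w, Fin (m w) → X → ZMod 2) := fun Y =>
    Fintype.piFinset fun w => Fintype.piFinset fun _ => {v | ∑ x ∈ Y with inc w x, v x = 0}
    with hbad
  have hcover : (univ : Finset (∀ w, Fin (m w) → X → ZMod 2)) ⊆ 𝒴.biUnion bad := by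
    intro ω _
    obtain ⟨Y, hY, hY'⟩ := hcon ω
    simp only [mem_biUnion, hbad, Fintype.mem_piFinset, mem_filter, mem_univ, true_and]
    exact ⟨Y, hY, hY'⟩
  set N : ℝ := 2 ^ Fintype.card X with hN
  have hNpos : 0 < N := by positivity
  have hbadcard : ∀ Y, (#(bad Y) : ℝ) ≤
      (∏ w, N ^ m w) * ∏ w with ∃ x ∈ Y, inc w x, (1 / 2 : ℝ) ^ m w := by
    intro Y
    rw [prod_filter, ← prod_mul_distrib]
    simp only [hbad, Fintype.card_piFinset, prod_const, card_univ, Fintype.card_fin]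
    push_cast
    refine prod_le_prod (fun _ _ => by positivity) fun w _ => ?_
    split_ifs with hw
    · rw [← mul_pow]
      refine pow_le_pow_left₀ (by positivity) ?_ _
      obtain ⟨x, hx, hwx⟩ := hw
      have := two_mul_card_filter_sum_eq_zero_le (Y.filter (inc w)) ⟨x, by simp [hx, hwx]⟩
      have h2 : (2 * #{v : X → ZMod 2 | ∑ x ∈ Y with inc w x, v x = 0} : ℝ) ≤ N := by
        rw [hN]; exact_mod_cast this
      linarith
    · rw [mul_one]
      refine pow_le_pow_left₀ (by positivity) ?_ _
      have := card_le_univ ({v : X → ZMod 2 | ∑ x ∈ Y with inc w x, v x = 0} : Finset _)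
      have h3 : Fintype.card (X → ZMod 2) = 2 ^ Fintype.card X := by simp [ZMod.card]
      rw [h3] at this
      rw [hN]; exact_mod_cast this
  have htot : (∏ w, N ^ m w) ≤ ∑ Y ∈ 𝒴, (#(bad Y) : ℝ) := by
    have h1 := (card_le_card hcover).trans card_biUnion_le
    have h2 : #(univ : Finset (∀ w, Fin (m w) → X → ZMod 2)) =
        ∏ w, (2 ^ Fintype.card X) ^ m w := by
      simp [Finset.card_univ, ZMod.card]
    rw [h2] at h1
    rw [hN]; exact_mod_cast h1
  have h4 : (∏ w, N ^ m w) ≤ (∏ w, N ^ m w) *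
      ∑ Y ∈ 𝒴, ∏ w with ∃ x ∈ Y, inc w x, (1 / 2 : ℝ) ^ m w := by
    rw [mul_sum]
    exact htot.trans (sum_le_sum fun Y _ => hbadcard Y)
  have h5 : 0 < ∏ w, N ^ m w := prod_pos fun _ _ => by positivity
  nlinarith

open Finset in
open scoped Classical in
/-- If no functional supported in `Z` annihilates the coefficients, then every pattern on `Z` is a
combination of them. -/
theorem exists_combination_of_separating {X W : Type*} [Fintype X] [Fintype W]
    (inc : W → X → Prop) (m : W → ℕ) (ω : ∀ w, Fin (m w) → X → ZMod 2) (Z : Finset X)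
    (h : ∀ Y ⊆ Z, Y.Nonempty → ∃ w s, ∑ x ∈ Y with inc w x, ω w s x ≠ 0) (f : X → ZMod 2) :
    ∃ z : ∀ w, Fin (m w) → ZMod 2,
      ∀ x ∈ Z, ∑ w with inc w x, ∑ s, z w s * ω w s x = f x := by
  let Φ : (∀ w, Fin (m w) → ZMod 2) →ₗ[ZMod 2] (Z → ZMod 2) :=
    { toFun := fun z x => ∑ w with inc w x, ∑ s, z w s * ω w s x
      map_add' := by
        intro z z'; ext x
        simp [add_mul, sum_add_distrib]
      map_smul' := by
        intro c z; ext x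
        simp [mul_sum, mul_assoc] }
  suffices hΦ : LinearMap.range Φ = ⊤ by
    obtain ⟨z, hz⟩ := LinearMap.range_eq_top.1 hΦ fun x => f x
    exact ⟨z, fun x hx => congrFun hz ⟨x, hx⟩⟩
  by_contra hne
  obtain ⟨g, hg0, hg⟩ := Submodule.exists_le_ker_of_lt_top _ (lt_top_iff_ne_top.2 hne)
  have hgsum : ∀ v : Z → ZMod 2, g v = ∑ x, v x * g (Pi.single x 1) := by
    intro v
    conv_lhs => rw [pi_eq_sum_univ' v]
    simp [map_sum]
  -- Over 𝔽₂ a functional is summation over its support; if `g` kills the range of `Φ`, its support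
  -- is a set that no coefficient separates.
  set Y : Finset X := (univ.filter fun x : Z => g (Pi.single x 1) ≠ 0).map
    (Function.Embedding.subtype _) with hY
  have hYZ : Y ⊆ Z := by
    intro x hx
    simp only [hY, mem_map] at hx
    obtain ⟨y, _, rfl⟩ := hx
    exact y.2
  have hYne : Y.Nonempty := by
    by_contra hemp
    apply hg0
    ext x
    have : x ∉ univ.filter fun x : Z => g (Pi.single x 1) ≠ 0 := by
      intro hx
      exact hemp ⟨x, by rw [hY]; exact mem_map_of_mem _ hx⟩
    simpa using this
  obtain ⟨w, s, hws⟩ := h Y hYZ hYne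
  apply hws
  have h0 : g (Φ (Pi.single w (Pi.single s 1))) = 0 := hg ⟨_, rfl⟩
  rw [hgsum] at h0
  rw [← h0, hY, sum_filter, sum_map, sum_filter]
  refine sum_congr rfl fun x _ => ?_
  have key : Φ (Pi.single w (Pi.single s 1)) x = if inc w x then ω w s x else 0 := by
    change ∑ w' with inc w' (x : X), ∑ s', (Pi.single w (Pi.single s 1) :
      ∀ w, Fin (m w) → ZMod 2) w' s' * ω w' s' x = _
    rw [sum_filter, sum_eq_single w]
    · simp [Pi.single_apply]
    · intro w' _ hw'
      simp [hw']
    · simp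
  rw [key]
  have h01 : ∀ c : ZMod 2, c ≠ 0 → c = 1 := by decide
  by_cases h1 : g (Pi.single x 1) = 0
  · simp [h1]
  · simp only [h01 _ h1, ne_eq, one_ne_zero, not_false_eq_true, if_true, mul_one]
    congr

set_option maxHeartbeats 400000 in
open Finset in
/-- Universal coefficients for the cells of an `n × n` board: if every `R × C` fitting into an
`a × b` corner with `a + b = n` contains few cells of `D` compared to the budget of its lines, then
one choice of coefficients serves all corners at once. -/
theorem exists_universal_coeffs (n : ℕ) (D : Fin n → Fin n → Prop) [∀ i j, Decidable (D i j)]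
    (m : Bool × Fin n → ℕ) (q : ℕ) (hq : (1 + (1 / 2 : ℝ) ^ q) ^ (2 * n) < 7 / 4)
    (hall : ∀ a b, a + b = n → ∀ R C : Finset (Fin n), R.Nonempty → C.Nonempty →
      (∀ i ∈ R, (i : ℕ) < a) → (∀ j ∈ C, (j : ℕ) < b) →
      #{x ∈ R ×ˢ C | D x.1 x.2} + min (q * (#R + #C)) (2 * n + 2) ≤
        ∑ i ∈ R, m (true, i) + ∑ j ∈ C, m (false, j)) :
    ∃ ω : ∀ w, Fin (m w) → Fin n × Fin n → ZMod 2, ∀ a b, a + b = n →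
      ∀ f : Fin n → Fin n → ZMod 2, ∃ z : ∀ w, Fin (m w) → ZMod 2,
        ∀ i j : Fin n, (i : ℕ) < a → (j : ℕ) < b → D i j →
          ∑ s, z (true, i) s * ω (true, i) s (i, j) +
            ∑ s, z (false, j) s * ω (false, j) s (i, j) = f i j := by
  classical
  obtain ⟨inc, hinc⟩ : ∃ inc : Bool × Fin n → Fin n × Fin n → Prop,
      ∀ w x, inc w x ↔ w.2 = bif w.1 then x.1 else x.2 := ⟨_, fun _ _ => Iff.rfl⟩
  let cells : ℕ → ℕ → Finset (Fin n × Fin n) := fun a b =>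
    {x | (x.1 : ℕ) < a ∧ (x.2 : ℕ) < b ∧ D x.1 x.2}
  let 𝒴 : Finset (Finset (Fin n × Fin n)) :=
    {Y | Y.Nonempty ∧ ∃ a b, a + b = n ∧ Y ⊆ cells a b}
  let sh : Finset (Fin n × Fin n) → Finset (Fin n) × Finset (Fin n) :=
    fun Y => (Y.image Prod.fst, Y.image Prod.snd)
  have hprod : ∀ Y, ∏ w with ∃ x ∈ Y, inc w x, (1 / 2 : ℝ) ^ m w =
      (1 / 2 : ℝ) ^ (∑ i ∈ (sh Y).1, m (true, i) + ∑ j ∈ (sh Y).2, m (false, j)) := by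
    intro Y
    rw [prod_pow_eq_pow_sum]
    congr 1
    rw [sum_filter, Fintype.sum_prod_type, Fintype.sum_bool, ← sum_filter, ← sum_filter]
    congr 1
    · refine sum_congr ?_ fun _ _ => rfl
      ext i; simp [hinc, sh, eq_comm]
    · refine sum_congr ?_ fun _ _ => rfl
      ext i; simp [hinc, sh, eq_comm]
  set x : ℝ := (1 / 2) ^ q with hx
  -- Sets `Y` are grouped by their projections `(R, C)`; the two terms cover the two arms of the
  -- minimum in `hall`.
  let G : Finset (Fin n) × Finset (Fin n) → ℝ := fun P =>
    x ^ #P.1 * x ^ #P.2 + (1 / 2) ^ (2 * n + 2)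
  have hfib : ∀ P ∈ (univ : Finset (Finset (Fin n) × Finset (Fin n))).erase (∅, ∅),
      ∑ Y ∈ 𝒴 with sh Y = P, ∏ w with ∃ x ∈ Y, inc w x, (1 / 2 : ℝ) ^ m w ≤ G P := by
    rintro ⟨R, C⟩ -
    have hG : 0 ≤ G (R, C) := by positivity
    rcases eq_empty_or_nonempty (𝒴.filter fun Y => sh Y = (R, C)) with he | ⟨Y₀, hY₀⟩
    · rw [he]; simpa using hG
    have hd : #{Y ∈ 𝒴 | sh Y = (R, C)} ≤ 2 ^ #{x ∈ R ×ˢ C | D x.1 x.2} := by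
      rw [← card_powerset]
      refine card_le_card fun Y hY => ?_
      simp only [𝒴, sh, mem_filter, mem_univ, true_and, Prod.mk.injEq] at hY
      obtain ⟨⟨-, a, b, -, hYab⟩, rfl, rfl⟩ := hY
      rw [mem_powerset]
      intro c hc
      have := hYab hc
      simp only [cells, mem_filter, mem_univ, true_and] at this
      simp only [mem_filter, mem_product]
      exact ⟨⟨mem_image_of_mem _ hc, mem_image_of_mem _ hc⟩, this.2.2⟩
    have hbud : #{x ∈ R ×ˢ C | D x.1 x.2} + min (q * (#R + #C)) (2 * n + 2) ≤
        ∑ i ∈ R, m (true, i) + ∑ j ∈ C, m (false, j) := by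
      simp only [𝒴, sh, mem_filter, mem_univ, true_and, Prod.mk.injEq] at hY₀
      obtain ⟨⟨hne, a, b, hab, hYab⟩, rfl, rfl⟩ := hY₀
      refine hall a b hab _ _ (hne.image _) (hne.image _) ?_ ?_
      · intro i hi
        obtain ⟨c, hc, rfl⟩ := mem_image.1 hi
        have := hYab hc
        simp only [cells, mem_filter, mem_univ, true_and] at this
        exact this.1
      · intro i hi
        obtain ⟨c, hc, rfl⟩ := mem_image.1 hi
        have := hYab hc
        simp only [cells, mem_filter, mem_univ, true_and] at this
        exact this.2.1
    calc ∑ Y ∈ 𝒴 with sh Y = (R, C), ∏ w with ∃ x ∈ Y, inc w x, (1 / 2 : ℝ) ^ m w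
        = ∑ Y ∈ 𝒴 with sh Y = (R, C),
            (1 / 2 : ℝ) ^ (∑ i ∈ R, m (true, i) + ∑ j ∈ C, m (false, j)) := by
          refine sum_congr rfl fun Y hY => ?_
          rw [hprod, (mem_filter.1 hY).2]
      _ ≤ 2 ^ #{x ∈ R ×ˢ C | D x.1 x.2} *
            (1 / 2 : ℝ) ^ (∑ i ∈ R, m (true, i) + ∑ j ∈ C, m (false, j)) := by
          rw [sum_const, nsmul_eq_mul]
          refine mul_le_mul_of_nonneg_right ?_ (by positivity)
          exact_mod_cast hd
      _ ≤ 2 ^ #{x ∈ R ×ˢ C | D x.1 x.2} *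
            (1 / 2 : ℝ) ^ (#{x ∈ R ×ˢ C | D x.1 x.2} + min (q * (#R + #C)) (2 * n + 2)) := by
          refine mul_le_mul_of_nonneg_left ?_ (by positivity)
          exact pow_le_pow_of_le_one (by norm_num) (by norm_num) hbud
      _ = (1 / 2 : ℝ) ^ min (q * (#R + #C)) (2 * n + 2) := by
          rw [pow_add, ← mul_assoc, ← mul_pow]; norm_num
      _ ≤ G (R, C) := by
          have e1 : x ^ #R * x ^ #C = (1 / 2 : ℝ) ^ (q * (#R + #C)) := by
            rw [← pow_add, hx, ← pow_mul]
          have p1 : (0 : ℝ) < (1 / 2 : ℝ) ^ (q * (#R + #C)) := by positivity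
          have p2 : (0 : ℝ) < (1 / 2 : ℝ) ^ (2 * n + 2) := by positivity
          simp only [G, e1]
          rcases min_choice (q * (#R + #C)) (2 * n + 2) with h | h <;> rw [h] <;> linarith
  have hsum : ∑ Y ∈ 𝒴, ∏ w with ∃ x ∈ Y, inc w x, (1 / 2 : ℝ) ^ m w < 1 := by
    have hmap : ∀ Y ∈ 𝒴, sh Y ∈
        (univ : Finset (Finset (Fin n) × Finset (Fin n))).erase (∅, ∅) := by
      intro Y hY
      simp only [𝒴, mem_filter, mem_univ, true_and] at hY
      simp [sh, hY.1.ne_empty]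
    rw [← sum_fiberwise_of_maps_to hmap]
    have hx0 : 0 < x := by positivity
    have h1 : ∑ P : Finset (Fin n) × Finset (Fin n), G P = (1 + x) ^ (2 * n) + 1 / 4 := by
      have hpow : ∑ R : Finset (Fin n), x ^ #R = (1 + x) ^ n := by
        have := Fin.sum_pow_mul_eq_add_pow (n := n) x 1
        simpa [add_comm] using this
      simp only [G]
      rw [sum_add_distrib, Fintype.sum_prod_type]
      dsimp only
      rw [← Fintype.sum_mul_sum, hpow, sum_const, ← pow_add, ← two_mul, nsmul_eq_mul]
      congr 1
      simp only [card_univ, Fintype.card_prod, Fintype.card_finset, Fintype.card_fin]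
      push_cast
      rw [← pow_add, ← two_mul, pow_add (1 / 2 : ℝ), ← mul_assoc, ← mul_pow]
      norm_num
    have h2 : ∑ P ∈ (univ : Finset (Finset (Fin n) × Finset (Fin n))).erase (∅, ∅), G P =
        (1 + x) ^ (2 * n) + 1 / 4 - G (∅, ∅) := by
      rw [← h1, ← add_sum_erase _ G (mem_univ (∅, ∅))]; ring
    -- The 4^n pairs contribute 1/4 through the second term and less than 7/4 through the first;
    -- leaving out the empty pair brings the total below 1.
    have h3 : 1 < G (∅, ∅) := by
      simp only [G]; norm_num
    have h4 := sum_le_sum hfib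
    linarith
  obtain ⟨ω, hω⟩ := exists_coeffs_separating inc m 𝒴 hsum
  refine ⟨ω, fun a b hab f => ?_⟩
  have hsep : ∀ Y ⊆ cells a b, Y.Nonempty → ∃ w s, ∑ x ∈ Y with inc w x, ω w s x ≠ 0 := by
    intro Y hY hne
    refine hω Y ?_
    simp only [𝒴, mem_filter, mem_univ, true_and]
    exact ⟨hne, a, b, hab, hY⟩
  obtain ⟨z, hz⟩ := exists_combination_of_separating inc m ω (cells a b) hsep
    (fun x => f x.1 x.2)
  clear hsep hω hsum
  refine ⟨z, fun i j hi hj hD => ?_⟩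
  have hmem : (i, j) ∈ cells a b := by
    simp only [cells, mem_filter, mem_univ, true_and]
    exact ⟨hi, hj, hD⟩
  have e := hz (i, j) hmem
  rw [sum_filter, Fintype.sum_prod_type, Fintype.sum_bool] at e
  simp only [hinc, cond_true, cond_false, sum_ite_eq', mem_univ, if_true] at e
  exact e

/-! ### Coding the parities of a monotone sequence -/

open Finset in
/-- A monotone sequence with values below `M` changes parity at most `M` times. -/
theorem exists_parity_changes (n M : ℕ) (V : ℕ → ℕ) (hV : Monotone V) (hM : ∀ i, V i < M) :
    ∃ T : Finset (Fin n), #T ≤ M ∧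
      ∀ i : Fin n, #{c ∈ T | c ≤ i} % 2 = V i % 2 := by
  -- The value before position 0 is taken to be 0, so that an odd start counts as a change.
  let P : ℕ → Prop := fun i => (if i = 0 then 0 else V (i - 1)) % 2 ≠ V i % 2
  have hP : DecidablePred P := fun i => by unfold P; infer_instance
  refine ⟨univ.filter fun i => P i, ?_, ?_⟩
  · rw [← card_range M]
    -- `V` increases strictly at each change, hence is injective on the changes.
    refine card_le_card_of_injOn (fun i : Fin n => V i) (fun i _ => by simpa using hM i) ?_
    have key : ∀ i j : Fin n, P j → i < j → V i < V j := by
      intro i j hj hij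
      have h1 : (i : ℕ) ≤ j - 1 := by have : (i : ℕ) < j := hij; omega
      have h2 := hV h1
      have h3 : V (j - 1) ≤ V j := hV (by omega)
      have h4 : V (j - 1) ≠ V j := by
        intro h
        have : (j : ℕ) ≠ 0 := by have : (i : ℕ) < j := hij; omega
        simp only [P, if_neg this, h] at hj
        exact hj rfl
      omega
    intro i hi j hj h
    simp only [coe_filter, mem_univ, true_and] at hi hj
    rcases lt_trichotomy i j with hij | hij | hij
    · exact absurd h (key i j hj hij).ne
    · exact hij
    · exact absurd h (key j i hi hij).ne'
  · have key : ∀ i, (hi : i < n) →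
        #{c ∈ univ.filter fun i : Fin n => P i | c ≤ ⟨i, hi⟩} % 2 = V i % 2 := by
      intro i
      induction i with
      | zero =>
        intro hi
        by_cases h0 : P 0
        · have : ({c ∈ univ.filter fun i : Fin n => P i | c ≤ ⟨0, hi⟩} : Finset (Fin n)) =
              {⟨0, hi⟩} := by
            ext c; simp only [mem_filter, mem_univ, true_and, mem_singleton, Fin.ext_iff,
              Fin.le_def]
            constructor
            · rintro ⟨-, h⟩; omega
            · intro h; rw [h]; exact ⟨h0, le_rfl⟩
          rw [this]
          simp only [P, if_true] at h0
          simp only [card_singleton]; omega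
        · have : ({c ∈ univ.filter fun i : Fin n => P i | c ≤ ⟨0, hi⟩} : Finset (Fin n)) =
              ∅ := by
            ext c; simp only [mem_filter, mem_univ, true_and, Fin.le_def, notMem_empty, iff_false]
            rintro ⟨h, h'⟩
            have : (c : ℕ) = 0 := by omega
            rw [this] at h; exact h0 h
          rw [this]
          simp only [P, if_true] at h0
          simp only [card_empty]; omega
      | succ i ih =>
        intro hi
        have ih' := ih (by omega)
        by_cases h0 : P (i + 1)
        · have : ({c ∈ univ.filter fun i : Fin n => P i | c ≤ ⟨i + 1, hi⟩} : Finset (Fin n)) =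
              insert ⟨i + 1, hi⟩
                {c ∈ univ.filter fun i : Fin n => P i | c ≤ ⟨i, by omega⟩} := by
            ext c; simp only [mem_filter, mem_univ, true_and, mem_insert, Fin.ext_iff,
              Fin.le_def]
            constructor
            · rintro ⟨h, h'⟩
              by_cases hc : (c : ℕ) = i + 1
              · exact Or.inl hc
              · exact Or.inr ⟨h, by omega⟩
            · rintro (h | ⟨h, h'⟩)
              · rw [h]; exact ⟨h0, le_rfl⟩
              · exact ⟨h, by omega⟩
          rw [this, card_insert_of_notMem (by simp)]
          simp only [P, if_neg (Nat.succ_ne_zero i), Nat.add_sub_cancel] at h0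
          omega
        · have : ({c ∈ univ.filter fun i : Fin n => P i | c ≤ ⟨i + 1, hi⟩} : Finset (Fin n)) =
              {c ∈ univ.filter fun i : Fin n => P i | c ≤ ⟨i, by omega⟩} := by
            ext c; simp only [mem_filter, mem_univ, true_and, Fin.le_def]
            constructor
            · rintro ⟨h, h'⟩
              refine ⟨h, ?_⟩
              have : (c : ℕ) ≠ i + 1 := fun hc => h0 (hc ▸ h)
              omega
            · rintro ⟨h, h'⟩
              exact ⟨h, by omega⟩
          rw [this]
          simp only [P, if_neg (Nat.succ_ne_zero i), Nat.add_sub_cancel] at h0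
          omega
    exact fun i => key i i.2

-- Give each set `R` the weight x^|R| with x = 2^(-w). The total is (1 + x)^n ≤ e^M ≤ 4^M, while
-- each set counted weighs at least x^M.
open Finset in
theorem card_small_sets_le (n w M : ℕ) (hn : n ≤ 2 ^ w * M) :
    #{T : Finset (Fin n) | #T ≤ M} ≤ 2 ^ (M * (w + 2)) := by
  set x : ℝ := (1 / 2) ^ w with hx
  have hx0 : 0 < x := by positivity
  have hx1 : x ≤ 1 := pow_le_one₀ (by norm_num) (by norm_num)
  have h1 : (#{T : Finset (Fin n) | #T ≤ M} : ℝ) * x ^ M ≤ (1 + x) ^ n := by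
    have hpow : ∑ R : Finset (Fin n), x ^ #R = (1 + x) ^ n := by
      have := Fin.sum_pow_mul_eq_add_pow (n := n) x 1
      simpa [add_comm] using this
    rw [← hpow, ← nsmul_eq_mul, ← sum_const]
    refine (sum_le_sum fun T hT => ?_).trans
      (sum_le_sum_of_subset_of_nonneg (filter_subset _ _) fun _ _ _ => by positivity)
    exact pow_le_pow_of_le_one hx0.le hx1 (mem_filter.1 hT).2
  have h2 : (1 + x) ^ n ≤ 4 ^ M := by
    have hxn : x * n ≤ M := by
      have : (n : ℝ) ≤ 2 ^ w * M := by exact_mod_cast hn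
      calc x * n ≤ x * (2 ^ w * M) := by gcongr
        _ = M := by rw [hx, ← mul_assoc, ← mul_pow]; norm_num
    calc (1 + x) ^ n ≤ Real.exp x ^ n := by
          gcongr; rw [add_comm]; exact Real.add_one_le_exp x
      _ = Real.exp (x * n) := by rw [← Real.exp_nat_mul, mul_comm]
      _ ≤ Real.exp M := Real.exp_le_exp.2 hxn
      _ = Real.exp 1 ^ M := by rw [← Real.exp_nat_mul, mul_one]
      _ ≤ 4 ^ M := by
          gcongr
          exact (Real.exp_one_lt_d9.le).trans (by norm_num)
  have h3 : (#{T : Finset (Fin n) | #T ≤ M} : ℝ) ≤ 2 ^ (M * (w + 2)) := by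
    have e1 : x ^ M * 2 ^ (M * w) = 1 := by
      rw [hx, ← pow_mul, mul_comm w M, ← mul_pow]; norm_num
    calc (#{T : Finset (Fin n) | #T ≤ M} : ℝ)
        = (#{T : Finset (Fin n) | #T ≤ M} : ℝ) * x ^ M * 2 ^ (M * w) := by
          rw [mul_assoc, e1, mul_one]
      _ ≤ 4 ^ M * 2 ^ (M * w) := by gcongr; exact h1.trans h2
      _ = 2 ^ (M * (w + 2)) := by
          rw [show (4 : ℝ) = 2 ^ 2 by norm_num, ← pow_mul, ← pow_add]; congr 1; ring
  exact_mod_cast h3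

open Finset in
/-- The parities of a monotone sequence with values below `M`, read on an arbitrary index set, can
be coded with `M * (w + 2)` bits when `n ≤ 2 ^ w * M`. -/
theorem exists_parity_decoder (n w M : ℕ) (hn : n ≤ 2 ^ w * M) :
    ∃ dec : (Fin (M * (w + 2)) → Bool) → ℕ → Bool,
      ∀ (P : ℕ → Prop) (v : ℕ → ℕ), (∀ i j, P i → P j → i ≤ j → v i ≤ v j) →
        (∀ i, P i → v i < M) → ∃ y, ∀ i < n, P i → dec y i = decide (v i % 2 = 1) := by
  classical
  let 𝒯 : Finset (Finset (Fin n)) := {T | #T ≤ M}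
  have hcard : Fintype.card 𝒯 ≤ Fintype.card (Fin (M * (w + 2)) → Bool) := by
    rw [Fintype.card_coe]
    simpa using card_small_sets_le n w M hn
  obtain ⟨g⟩ := Function.Embedding.nonempty_of_card_le hcard
  have : Nonempty 𝒯 := ⟨⟨∅, by simp [𝒯]⟩⟩
  refine ⟨fun y i => decide (#((Function.invFun g y).1.filter fun c : Fin n => (c : ℕ) ≤ i) % 2 = 1),
    fun P v hmono hlt => ?_⟩
  rcases Nat.eq_zero_or_pos M with rfl | hM
  · refine ⟨fun _ => false, fun i _ hi => absurd (hlt i hi) (by omega)⟩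
  -- The running maximum extends `v` monotonically from `P` to all positions.
  let V : ℕ → ℕ := fun i => (range (i + 1)).sup fun c => if P c then v c else 0
  have hVm : Monotone V := fun i j hij => sup_mono (range_subset_range.2 (by omega))
  have hVlt : ∀ i, V i < M := fun i => (Finset.sup_lt_iff hM).2 fun c _ => by
    split_ifs with h
    · exact hlt c h
    · exact hM
  have hVP : ∀ i, P i → V i = v i := by
    intro i hi
    apply le_antisymm
    · refine Finset.sup_le fun c hc => ?_
      split_ifs with h
      · exact hmono c i h hi (by simp at hc; omega)
      · exact Nat.zero_le _
    · have := Finset.le_sup (f := fun c => if P c then v c else 0) (self_mem_range_succ i)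
      simpa [hi] using this
  obtain ⟨T, hT, hTV⟩ := exists_parity_changes n M V hVm hVlt
  refine ⟨g ⟨T, by simpa [𝒯] using hT⟩, fun i hi hPi => ?_⟩
  dsimp only
  rw [Function.leftInverse_invFun g.injective]
  have := hTV ⟨i, hi⟩
  simp only [Fin.le_def] at this
  simp only [this, hVP i hPi]

/-! ### Sorting, and the cells it determines -/

/-- Within every class of `cls`, a permutation can sort the values of `key`. -/
theorem exists_perm_sorting_classes {n : ℕ} (cls key : Fin n → ℕ) :
    ∃ σ : Equiv.Perm (Fin n), (∀ i, cls (σ i) = cls i) ∧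
      ∀ i j, i ≤ j → cls i = cls j → key (σ i) ≤ key (σ j) := by
  classical
  let S := {σ : Equiv.Perm (Fin n) // ∀ i, cls (σ i) = cls i}
  have : Nonempty S := ⟨⟨1, fun _ => rfl⟩⟩
  -- Rearrangement: at a maximum of `F` no class has an inversion, since swapping it would increase
  -- the sum.
  let F : S → ℤ := fun σ => ∑ i : Fin n, ((i : ℕ) : ℤ) * key (σ.1 i)
  obtain ⟨⟨σ, hσ⟩, hmax⟩ := Finite.exists_max F
  refine ⟨σ, hσ, fun i j hij hc => ?_⟩
  by_contra! hlt
  have hne : i ≠ j := by rintro rfl; exact lt_irrefl _ hlt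
  have hij' : ((i : ℕ) : ℤ) < (j : ℕ) := by
    have : i < j := lt_of_le_of_ne hij hne
    exact_mod_cast this
  have hτ : ∀ k, cls ((σ * Equiv.swap i j) k) = cls k := by
    intro k
    rw [Equiv.Perm.mul_apply, hσ]
    by_cases hki : k = i
    · subst hki; simp [hc]
    · by_cases hkj : k = j
      · subst hkj; simp [hc]
      · rw [Equiv.swap_apply_of_ne_of_ne hki hkj]
  have h1 := hmax ⟨σ * Equiv.swap i j, hτ⟩
  simp only [F, Equiv.Perm.mul_apply] at h1
  have h2 : ∑ k : Fin n, ((k : ℕ) : ℤ) * key (σ (Equiv.swap i j k)) =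
      ∑ k : Fin n, ((Equiv.swap i j k : ℕ) : ℤ) * key (σ k) := by
    rw [← Equiv.sum_comp (Equiv.swap i j)]
    simp
  rw [h2, ← sub_nonpos, ← Finset.sum_sub_distrib, Fintype.sum_eq_add i j hne] at h1
  · simp only [Equiv.swap_apply_left, Equiv.swap_apply_right] at h1
    have h3 : (key (σ j) : ℤ) < key (σ i) := by exact_mod_cast hlt
    nlinarith
  · rintro k ⟨hki, hkj⟩
    rw [Equiv.swap_apply_of_ne_of_ne hki hkj, sub_self]

/-- Number of bits reserved, at position `i`, for coding a row sorted by the opposite side. -/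
def rowCost (p K i : ℕ) : ℕ :=
  if i < 2 * K then 2 ^ (i / 2 + 1) * (p - i / 2 - 1 + 2) else 0

/-- The cells of the board that are determined by the order of the vertices of one side. -/
def SortedCell (K i j : ℕ) : Prop :=
  i % 2 = j % 2 ∧ ((i < 2 * K ∧ 2 * K ≤ j) ∨ (j < 2 * K ∧ 2 * K ≤ i))

instance (K i j : ℕ) : Decidable (SortedCell K i j) := by
  unfold SortedCell; infer_instance


/-! ### Cell counts against tag budgets -/

section

open Finset

theorem sum_range_level_cost (p K : ℕ) (h : K ≤ p) :
    ∑ l ∈ range K, 2 ^ (l + 1) * (p - l - 1 + 2) ≤ 2 ^ (K + 1) * (p - K + 3) := by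
  induction K with
  | zero => simp
  | succ K ih =>
    rw [sum_range_succ]
    have h1 := ih (by omega)
    obtain ⟨d, rfl⟩ : ∃ d, p = K + 1 + d := ⟨p - (K + 1), by omega⟩
    rw [show K + 1 + d - K = d + 1 by omega] at h1 ⊢
    rw [show K + 1 + d - (K + 1) = d by omega, show d + 1 - 1 = d by omega]
    calc _ ≤ 2 ^ (K + 1) * (d + 1 + 3) + 2 ^ (K + 1) * (d + 2) := by gcongr
      _ = 2 ^ (K + 1 + 1) * (d + 3) := by ring

theorem sum_range_rowCost (p K : ℕ) :
    ∑ i ∈ range (2 * K), rowCost p K i =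
      2 * ∑ l ∈ range K, 2 ^ (l + 1) * (p - l - 1 + 2) := by
  have h : ∀ k ≤ K, ∑ i ∈ range (2 * k), rowCost p K i =
      2 * ∑ l ∈ range k, 2 ^ (l + 1) * (p - l - 1 + 2) := by
    intro k
    induction k with
    | zero => simp
    | succ k ih =>
      intro hk
      rw [show 2 * (k + 1) = 2 * k + 1 + 1 by ring, sum_range_succ, sum_range_succ,
        ih (by omega), sum_range_succ, mul_add]
      have h1 : rowCost p K (2 * k) = 2 ^ (k + 1) * (p - k - 1 + 2) := by
        rw [rowCost, if_pos (by omega), show 2 * k / 2 = k by omega]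
      have h2 : rowCost p K (2 * k + 1) = 2 ^ (k + 1) * (p - k - 1 + 2) := by
        rw [rowCost, if_pos (by omega), show (2 * k + 1) / 2 = k by omega]
      rw [h1, h2]; ring
  exact h K le_rfl

theorem sum_rowCost_le {n : ℕ} (p K : ℕ) (R : Finset (Fin n)) :
    ∑ i ∈ R, rowCost p K i ≤ 2 * ∑ l ∈ range K, 2 ^ (l + 1) * (p - l - 1 + 2) := by
  rw [← sum_range_rowCost]
  have : ∑ i ∈ R, rowCost p K i = ∑ i ∈ R.map Fin.valEmbedding, rowCost p K i := by
    rw [sum_map]; rfl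
  rw [this]
  refine sum_le_sum_of_ne_zero fun i _ hi => ?_
  rw [mem_range]
  by_contra h
  exact hi (by rw [rowCost, if_neg h])

theorem rowCost_le (p K i : ℕ) :
    rowCost p K i ≤ ∑ l ∈ range K, 2 ^ (l + 1) * (p - l - 1 + 2) := by
  unfold rowCost
  split_ifs with h
  · exact single_le_sum (f := fun l => 2 ^ (l + 1) * (p - l - 1 + 2))
      (fun _ _ => Nat.zero_le _) (mem_range.2 (by omega : i / 2 < K))
  · exact Nat.zero_le _

/-- Positions of parity `g` below `2 * K`. -/
def specialPart {n : ℕ} (K g : ℕ) (R : Finset (Fin n)) : Finset (Fin n) :=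
  {i ∈ R | (i : ℕ) < 2 * K ∧ (i : ℕ) % 2 = g}

/-- Positions of parity `g` from `2 * K` on. -/
def ordinaryPart {n : ℕ} (K g : ℕ) (R : Finset (Fin n)) : Finset (Fin n) :=
  {i ∈ R | 2 * K ≤ (i : ℕ) ∧ (i : ℕ) % 2 = g}

theorem card_eq_sum_parts {n : ℕ} (K : ℕ) (R : Finset (Fin n)) :
    #R = #(ordinaryPart K 0 R) + #(ordinaryPart K 1 R) + #(specialPart K 0 R) +
      #(specialPart K 1 R) := by
  simp only [ordinaryPart, specialPart, card_filter]
  rw [← sum_add_distrib, ← sum_add_distrib, ← sum_add_distrib, card_eq_sum_ones]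
  refine sum_congr rfl fun i _ => ?_
  rcases Nat.mod_two_eq_zero_or_one i with h | h <;> by_cases h2 : (i : ℕ) < 2 * K <;>
    simp [h, h2, Nat.not_le.2, Nat.le_of_not_lt]

theorem card_specialPart_le {n : ℕ} (K g : ℕ) (R : Finset (Fin n)) :
    #(specialPart K g R) ≤ K := by
  conv_rhs => rw [← card_range K]
  refine card_le_card_of_injOn (fun i => (i : ℕ) / 2) ?_ ?_
  · intro i hi
    simp only [specialPart, coe_filter, Set.mem_ofPred_eq] at hi
    simp only [coe_range, Set.mem_Iio]
    omega
  · intro i hi j hj h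
    simp only [specialPart, coe_filter, Set.mem_ofPred_eq] at hi hj
    dsimp only at h
    exact Fin.ext (by omega)

theorem two_mul_card_ordinaryPart_le {n : ℕ} (K g a : ℕ) (R : Finset (Fin n)) (ha : 2 * K ≤ a)
    (hR : ∀ i ∈ R, (i : ℕ) < a) : 2 * #(ordinaryPart K g R) ≤ a - 2 * K + 1 := by
  have : #(ordinaryPart K g R) ≤ #(range ((a - 2 * K + 1) / 2)) := by
    refine card_le_card_of_injOn (fun i => ((i : ℕ) - 2 * K) / 2) ?_ ?_
    · intro i hi
      simp only [ordinaryPart, coe_filter, Set.mem_ofPred_eq] at hi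
      have := hR i hi.1
      simp only [coe_range, Set.mem_Iio]
      omega
    · intro i hi j hj h
      simp only [ordinaryPart, coe_filter, Set.mem_ofPred_eq] at hi hj
      dsimp only at h
      exact Fin.ext (by omega)
  rw [card_range] at this
  omega

theorem card_ordinaryPart_add_le {n : ℕ} (K a : ℕ) (R : Finset (Fin n))
    (hR : ∀ i ∈ R, (i : ℕ) < a) :
    #(ordinaryPart K 0 R) + #(ordinaryPart K 1 R) ≤ a - 2 * K := by
  have hd : Disjoint (ordinaryPart K 0 R) (ordinaryPart K 1 R) := by
    rw [disjoint_left]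
    intro i hi hj
    simp only [ordinaryPart, mem_filter] at hi hj
    omega
  rw [← card_union_of_disjoint hd]
  conv_rhs => rw [← card_range (a - 2 * K)]
  refine card_le_card_of_injOn (fun i => (i : ℕ) - 2 * K) ?_ ?_
  · intro i hi
    simp only [ordinaryPart, coe_union, coe_filter, Set.mem_union, Set.mem_ofPred_eq] at hi
    have := hR i (by tauto)
    simp only [coe_range, Set.mem_Iio]
    omega
  · intro i hi j hj h
    simp only [ordinaryPart, coe_union, coe_filter, Set.mem_union, Set.mem_ofPred_eq] at hi hj
    dsimp only at h
    exact Fin.ext (by omega)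

theorem card_unsorted_le {n : ℕ} (K : ℕ) (R C : Finset (Fin n)) :
    #{x ∈ R ×ˢ C | ¬ SortedCell K x.1 x.2} ≤
      (#(ordinaryPart K 0 R) + #(ordinaryPart K 1 R)) *
        (#(ordinaryPart K 0 C) + #(ordinaryPart K 1 C)) +
      (#(specialPart K 0 R) + #(specialPart K 1 R)) *
        (#(specialPart K 0 C) + #(specialPart K 1 C)) +
      #(specialPart K 0 R) * #(ordinaryPart K 1 C) + #(specialPart K 1 R) * #(ordinaryPart K 0 C) +
      #(ordinaryPart K 1 R) * #(specialPart K 0 C) +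
      #(ordinaryPart K 0 R) * #(specialPart K 1 C) := by
  have hsub : {x ∈ R ×ˢ C | ¬ SortedCell K x.1 x.2} ⊆
      (ordinaryPart K 0 R ∪ ordinaryPart K 1 R) ×ˢ (ordinaryPart K 0 C ∪ ordinaryPart K 1 C) ∪
      (specialPart K 0 R ∪ specialPart K 1 R) ×ˢ (specialPart K 0 C ∪ specialPart K 1 C) ∪
      specialPart K 0 R ×ˢ ordinaryPart K 1 C ∪ specialPart K 1 R ×ˢ ordinaryPart K 0 C ∪
      ordinaryPart K 1 R ×ˢ specialPart K 0 C ∪ ordinaryPart K 0 R ×ˢ specialPart K 1 C := by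
    rintro ⟨i, j⟩ h
    rw [mem_filter, mem_product] at h
    simp only [SortedCell] at h
    simp only [mem_union, mem_product, ordinaryPart, specialPart, mem_filter, h.1.1, h.1.2,
      true_and]
    omega
  refine (card_le_card hsub).trans ?_
  refine (card_union_le _ _).trans (add_le_add ?_ (card_product _ _).le)
  refine (card_union_le _ _).trans (add_le_add ?_ (card_product _ _).le)
  refine (card_union_le _ _).trans (add_le_add ?_ (card_product _ _).le)
  refine (card_union_le _ _).trans (add_le_add ?_ (card_product _ _).le)
  refine (card_union_le _ _).trans (add_le_add ?_ ?_)
  · rw [card_product]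
    exact Nat.mul_le_mul (card_union_le _ _) (card_union_le _ _)
  · rw [card_product]
    exact Nat.mul_le_mul (card_union_le _ _) (card_union_le _ _)

/-- Here `r`, `c` count ordinary rows and columns and `s`, `t` special ones, by parity. For a = b,
each special line has about (a + b)/4 unsorted ordinary cells, which `T` pays for. An imbalance `x`
costs at most K|x|, recovered, up to K², from the deficit ((r + c)z + (r - c)²)/4 of the ordinary
rectangle. -/
theorem large_rectangle_inequality (n K T a b r₀ r₁ c₀ c₁ s₀ s₁ t₀ t₁ : ℝ)
    (hr₀ : 0 ≤ r₀) (hr₁ : 0 ≤ r₁) (hc₀ : 0 ≤ c₀) (hc₁ : 0 ≤ c₁)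
    (hs₀ : 0 ≤ s₀) (hs₁ : 0 ≤ s₁) (ht₀ : 0 ≤ t₀) (ht₁ : 0 ≤ t₁)
    (hs₀K : s₀ ≤ K) (hs₁K : s₁ ≤ K) (ht₀K : t₀ ≤ K) (ht₁K : t₁ ≤ K)
    (hr₀a : 2 * r₀ ≤ a + 1) (hr₁a : 2 * r₁ ≤ a + 1) (hc₀b : 2 * c₀ ≤ b + 1)
    (hc₁b : 2 * c₁ ≤ b + 1) (hra : r₀ + r₁ ≤ a) (hcb : c₀ + c₁ ≤ b)
    (_hab : a + b + 4 * K = n) (hT : (a + b) / 4 + 8 ≤ T)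
    (hk : 3 / 4 * n ≤ r₀ + r₁ + c₀ + c₁ + s₀ + s₁ + t₀ + t₁)
    (hK : 64 * K ≤ n) (hKn : 5 * K ^ 2 + 2 ≤ n) :
    (r₀ + r₁) * (c₀ + c₁) + (s₀ + s₁) * (t₀ + t₁) + s₀ * c₁ + s₁ * c₀ + r₁ * t₀ + r₀ * t₁ +
      3 * n + 2 ≤ (r₀ + r₁ + c₀ + c₁ + s₀ + s₁ + t₀ + t₁) * T := by
  have hK0 : 0 ≤ K := hs₀.trans hs₀K
  set x := (a - b) / 2 with hx
  have hsign : ((t₀ + t₁) - (s₀ + s₁)) * x / 2 ≤ K * |x| := by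
    have h1 : |(t₀ + t₁) - (s₀ + s₁)| ≤ 2 * K := abs_le.2 ⟨by linarith, by linarith⟩
    have h2 := (le_abs_self (((t₀ + t₁) - (s₀ + s₁)) * x)).trans_eq (abs_mul _ _)
    have h3 := mul_le_mul_of_nonneg_right h1 (abs_nonneg x)
    linarith
  have hst : (s₀ + s₁) * (t₀ + t₁) ≤ (2 * K) * (2 * K) := by
    apply mul_le_mul <;> linarith
  have e1 : r₁ * t₀ ≤ t₀ * ((a + b) / 4 + 8) + t₀ * x / 2 := by
    have : t₀ * r₁ ≤ t₀ * ((a + b) / 4 + 8 + x / 2) :=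
      mul_le_mul_of_nonneg_left (by rw [hx]; linarith) ht₀
    linarith
  have e2 : r₀ * t₁ ≤ t₁ * ((a + b) / 4 + 8) + t₁ * x / 2 := by
    have : t₁ * r₀ ≤ t₁ * ((a + b) / 4 + 8 + x / 2) :=
      mul_le_mul_of_nonneg_left (by rw [hx]; linarith) ht₁
    linarith
  have e3 : s₀ * c₁ ≤ s₀ * ((a + b) / 4 + 8) - s₀ * x / 2 := by
    have : s₀ * c₁ ≤ s₀ * ((a + b) / 4 + 8 - x / 2) :=
      mul_le_mul_of_nonneg_left (by rw [hx]; linarith) hs₀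
    linarith
  have e4 : s₁ * c₀ ≤ s₁ * ((a + b) / 4 + 8) - s₁ * x / 2 := by
    have : s₁ * c₀ ≤ s₁ * ((a + b) / 4 + 8 - x / 2) :=
      mul_le_mul_of_nonneg_left (by rw [hx]; linarith) hs₁
    linarith
  have e5 : (r₀ + r₁ + c₀ + c₁ + s₀ + s₁ + t₀ + t₁) * ((a + b) / 4 + 8) ≤
      (r₀ + r₁ + c₀ + c₁ + s₀ + s₁ + t₀ + t₁) * T :=
    mul_le_mul_of_nonneg_left hT (by linarith)
  obtain ⟨r, hr⟩ : ∃ r, r = r₀ + r₁ := ⟨_, rfl⟩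
  obtain ⟨c, hc⟩ : ∃ c, c = c₀ + c₁ := ⟨_, rfl⟩
  have hsum : r₀ + r₁ + c₀ + c₁ + s₀ + s₁ + t₀ + t₁ = r + c + s₀ + s₁ + t₀ + t₁ := by linarith
  rw [hsum, ← hr, ← hc]
  rw [← hr] at hra
  rw [← hc] at hcb
  rw [hsum] at e5 hk
  have hk' : n / 2 ≤ r + c := by linarith
  set z := a + b - (r + c) with hz
  have hz0 : 0 ≤ z := by linarith
  -- Either `z`, the number of missing ordinary lines, is at least |x|, or |r - c| ≥ |x| and (|x| -
  -- 2K)² ≥ 0 applies.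
  have hquad : 4 * K * |x| - 4 * K ^ 2 ≤ (r + c) * z + (r - c) ^ 2 := by
    rcases le_total |x| z with h | h
    · have h1 : 4 * K * |x| ≤ (r + c) * z :=
        mul_le_mul (by linarith) h (abs_nonneg _) (by linarith)
      linarith [sq_nonneg (r - c), sq_nonneg K]
    · have h1 : |x| ≤ |r - c| := by
        rcases abs_cases x with ⟨h2, h3⟩ | ⟨h2, h3⟩
        · rw [h2] at h ⊢
          exact le_trans (by linarith) (le_abs_self _)
        · rw [h2] at h ⊢
          exact le_trans (by linarith) (neg_le_abs (r - c))
      have h2 : |x| ^ 2 ≤ (r - c) ^ 2 := by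
        rw [← sq_abs (r - c)]
        exact pow_le_pow_left₀ (abs_nonneg _) h1 2
      have h3 := sq_nonneg (|x| - 2 * K)
      have h4 := mul_nonneg (by linarith : 0 ≤ r + c) hz0
      linarith
  have hid : r * c - (r + c) * ((a + b) / 4) = -((r + c) * z + (r - c) ^ 2) / 4 := by
    rw [hz]; ring
  linarith

theorem rectangle_budget (n K : ℕ) (hK : 64 * K ≤ n) (hKn : 5 * K ^ 2 + 2 ≤ n)
    (hp : 2 ^ (K + 11) ≤ 2 * n) (hp4 : K + 11 ≤ n / 4) (a b : ℕ) (hab : a + b = n)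
    (R C : Finset (Fin n)) (hRa : ∀ i ∈ R, (i : ℕ) < a) (hCb : ∀ j ∈ C, (j : ℕ) < b) :
    #{x ∈ R ×ˢ C | ¬ SortedCell K x.1 x.2} + min (n / 64 * (#R + #C)) (2 * n + 2) ≤
      ∑ i ∈ R, (n / 4 + 20 - (K + 11) - rowCost (K + 11) K i) +
        ∑ j ∈ C, (n / 4 + 20 - (K + 11) - rowCost (K + 11) K j) := by
  set S := ∑ l ∈ range K, 2 ^ (l + 1) * (K + 11 - l - 1 + 2) with hS
  set T := n / 4 + 20 - (K + 11) with hT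
  -- This fixes the 11: 36 · 14 · 2^(K+1) = 1008 · 2^K, while n ≥ 1024 · 2^K.
  have hSn : 36 * S ≤ n := by
    have h1 := sum_range_level_cost (K + 11) K (by omega)
    rw [show K + 11 - K + 3 = 14 by omega, pow_succ] at h1
    rw [pow_add] at hp
    omega
  have hcost : ∀ i, rowCost (K + 11) K i ≤ S := fun i => rowCost_le _ _ _
  have hST : S ≤ T := by omega
  have hsub : ∀ Q : Finset (Fin n), #Q * T ≤ ∑ i ∈ Q, (T - rowCost (K + 11) K i) + 2 * S := by
    intro Q
    have h1 := sum_rowCost_le (K + 11) K Q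
    rw [← hS] at h1
    have h2 : ∑ i ∈ Q, (T - rowCost (K + 11) K i) + ∑ i ∈ Q, rowCost (K + 11) K i = #Q * T := by
      rw [← sum_add_distrib, ← smul_eq_mul, ← sum_const]
      exact sum_congr rfl fun i _ => Nat.sub_add_cancel ((hcost i).trans hST)
    omega
  have hsub' : ∀ Q : Finset (Fin n), #Q * (T - S) ≤ ∑ i ∈ Q, (T - rowCost (K + 11) K i) := by
    intro Q
    rw [← smul_eq_mul, ← sum_const]
    exact sum_le_sum fun i _ => Nat.sub_le_sub_left (hcost i) T
  -- Thin or small rectangles have at most 3n/16 cells per line, leaving n/64 bits per line to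
  -- spare. Only the others need the sorted cells discounted.
  by_cases hsmall : 8 * #R ≤ n ∨ 8 * #C ≤ n ∨ 4 * (#R + #C) ≤ 3 * n
  · have hrc : 16 * (#R * #C) ≤ 3 * n * (#R + #C) := by
      rcases hsmall with h | h | h <;> nlinarith [sq_nonneg ((#R : ℤ) - #C)]
    have hd : #{x ∈ R ×ˢ C | ¬ SortedCell K x.1 x.2} ≤ #R * #C := by
      rw [← card_product]; exact card_filter_le _ _
    have hmin := min_le_left (n / 64 * (#R + #C)) (2 * n + 2)
    have hTS : 3 * n + 16 * (n / 64) ≤ 16 * (T - S) := by omega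
    have h1 := hsub' R
    have h2 := hsub' C
    have h3 : (3 * n + 16 * (n / 64)) * (#R + #C) ≤ 16 * (T - S) * (#R + #C) :=
      Nat.mul_le_mul_right _ hTS
    nlinarith
  · push Not at hsmall
    obtain ⟨hR8, hC8, hk⟩ := hsmall
    have hRc : #R ≤ a := by
      have := card_le_card_of_injOn (s := R) (t := range a) (fun i => (i : ℕ))
        (fun i hi => by simpa using hRa i hi) (fun i _ j _ h => Fin.ext h)
      rwa [card_range] at this
    have hCc : #C ≤ b := by
      have := card_le_card_of_injOn (s := C) (t := range b) (fun i => (i : ℕ))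
        (fun i hi => by simpa using hCb i hi) (fun i _ j _ h => Fin.ext h)
      rwa [card_range] at this
    have haK : 2 * K ≤ a := by omega
    have hbK : 2 * K ≤ b := by omega
    have hd := card_unsorted_le K R C
    have hRsum := card_eq_sum_parts K R
    have hCsum := card_eq_sum_parts K C
    have hr0 := two_mul_card_ordinaryPart_le K 0 a R haK hRa
    have hr1 := two_mul_card_ordinaryPart_le K 1 a R haK hRa
    have hc0 := two_mul_card_ordinaryPart_le K 0 b C hbK hCb
    have hc1 := two_mul_card_ordinaryPart_le K 1 b C hbK hCb
    have hr := card_ordinaryPart_add_le K a R hRa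
    have hc := card_ordinaryPart_add_le K b C hCb
    have hs0 := card_specialPart_le K 0 R
    have hs1 := card_specialPart_le K 1 R
    have ht0 := card_specialPart_le K 0 C
    have ht1 := card_specialPart_le K 1 C
    obtain ⟨a', rfl⟩ : ∃ a', a = a' + 2 * K := ⟨a - 2 * K, by omega⟩
    obtain ⟨b', rfl⟩ : ∃ b', b = b' + 2 * K := ⟨b - 2 * K, by omega⟩
    rw [Nat.add_sub_cancel] at hr0 hr1 hc0 hc1 hr hc
    have hT4 : a' + b' + 32 ≤ 4 * T := by omega
    have hk4 : 3 * n ≤ 4 * (#(ordinaryPart K 0 R) + #(ordinaryPart K 1 R) +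
        #(ordinaryPart K 0 C) + #(ordinaryPart K 1 C) + #(specialPart K 0 R) +
        #(specialPart K 1 R) + #(specialPart K 0 C) + #(specialPart K 1 C)) := by omega
    have hn : a' + b' + 4 * K = n := by omega
    have key := large_rectangle_inequality n K T a' b' #(ordinaryPart K 0 R)
      #(ordinaryPart K 1 R) #(ordinaryPart K 0 C) #(ordinaryPart K 1 C) #(specialPart K 0 R)
      #(specialPart K 1 R) #(specialPart K 0 C) #(specialPart K 1 C)
      (by positivity) (by positivity) (by positivity) (by positivity)
      (by positivity) (by positivity) (by positivity) (by positivity)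
      (by exact_mod_cast hs0) (by exact_mod_cast hs1) (by exact_mod_cast ht0)
      (by exact_mod_cast ht1) (by exact_mod_cast hr0) (by exact_mod_cast hr1)
      (by exact_mod_cast hc0) (by exact_mod_cast hc1) (by exact_mod_cast hr)
      (by exact_mod_cast hc) (by exact_mod_cast hn)
      (by have : ((a' + b' + 32 : ℕ) : ℝ) ≤ ((4 * T : ℕ) : ℝ) := by exact_mod_cast hT4
          push_cast at this; linarith)
      (by have : ((3 * n : ℕ) : ℝ) ≤ _ := Nat.cast_le.2 hk4
          push_cast at this; linarith)
      (by exact_mod_cast hK) (by exact_mod_cast hKn)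
    have key' : (#(ordinaryPart K 0 R) + #(ordinaryPart K 1 R)) *
        (#(ordinaryPart K 0 C) + #(ordinaryPart K 1 C)) +
      (#(specialPart K 0 R) + #(specialPart K 1 R)) *
        (#(specialPart K 0 C) + #(specialPart K 1 C)) +
      #(specialPart K 0 R) * #(ordinaryPart K 1 C) + #(specialPart K 1 R) * #(ordinaryPart K 0 C) +
      #(ordinaryPart K 1 R) * #(specialPart K 0 C) +
      #(ordinaryPart K 0 R) * #(specialPart K 1 C) + 3 * n + 2 ≤
      (#(ordinaryPart K 0 R) + #(ordinaryPart K 1 R) +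
        #(ordinaryPart K 0 C) + #(ordinaryPart K 1 C) + #(specialPart K 0 R) +
        #(specialPart K 1 R) + #(specialPart K 0 C) + #(specialPart K 1 C)) * T := by
      exact_mod_cast key
    have hkk : #(ordinaryPart K 0 R) + #(ordinaryPart K 1 R) +
        #(ordinaryPart K 0 C) + #(ordinaryPart K 1 C) + #(specialPart K 0 R) +
        #(specialPart K 1 R) + #(specialPart K 0 C) + #(specialPart K 1 C) = #R + #C := by omega
    rw [hkk, add_mul #R #C T] at key'
    -- The surplus 3n + 2 is the margin 2n + 2 plus n, which covers the 4S bits lost to row codes.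
    have hmin := min_le_right (n / 64 * (#R + #C)) (2 * n + 2)
    have h1 := hsub R
    have h2 := hsub C
    omega

/-! ### Sorted lines and the matrix scheme -/

/-- `dec` decodes, at every level below `K`, the rows that are sorted up to that level. -/
def IsRowDecoder (n p K : ℕ)
    (dec : ∀ l, (Fin (2 ^ (l + 1) * (p - l - 1 + 2)) → Bool) → ℕ → Bool) : Prop :=
  ∀ l < K, ∀ (P : ℕ → Prop) (v : ℕ → ℕ), (∀ i j, P i → P j → i ≤ j → v i ≤ v j) →
    (∀ i, P i → v i < 2 ^ (l + 1)) →
      ∃ y, ∀ i < n, P i → dec l y i = decide (v i % 2 = 1)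

theorem exists_isRowDecoder (n p K : ℕ) (hn : n ≤ 2 ^ p) (hK : K ≤ p) :
    ∃ dec, IsRowDecoder n p K dec := by
  have h : ∀ l, ∃ dec : (Fin (2 ^ (l + 1) * (p - l - 1 + 2)) → Bool) → ℕ → Bool, l < K →
      ∀ (P : ℕ → Prop) (v : ℕ → ℕ), (∀ i j, P i → P j → i ≤ j → v i ≤ v j) →
        (∀ i, P i → v i < 2 ^ (l + 1)) →
          ∃ y, ∀ i < n, P i → dec y i = decide (v i % 2 = 1) := by
    intro l
    by_cases hl : l < K
    · obtain ⟨dec, hdec⟩ := exists_parity_decoder n (p - l - 1) (2 ^ (l + 1)) (by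
        rw [← pow_add, show p - l - 1 + (l + 1) = p by omega]; exact hn)
      exact ⟨dec, fun _ => hdec⟩
    · exact ⟨fun _ _ => false, fun h => absurd h hl⟩
  choose dec hdec using h
  exact ⟨dec, hdec⟩

/-- In a sorted class the top l + 1 key bits form a monotone sequence, whose last bit is the entry
on the special line of level l. Special positions stay fixed, so sorting one side does not move the
lines by which the other is sorted. -/
theorem exists_sorting_perm (n p K : ℕ)
    (dec : ∀ l, (Fin (2 ^ (l + 1) * (p - l - 1 + 2)) → Bool) → ℕ → Bool)
    (hdec : IsRowDecoder n p K dec) {a b : ℕ} (ha : a ≤ n) (E : Fin a → Fin b → Bool) :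
    ∃ σ : Equiv.Perm (Fin a), (∀ i : Fin a, (i : ℕ) < 2 * K → σ i = i) ∧
      ∀ j : Fin b, (j : ℕ) < 2 * K → ∃ y, ∀ i : Fin a, 2 * K ≤ (i : ℕ) →
        (i : ℕ) % 2 = (j : ℕ) % 2 → dec (j / 2) y i = E (σ i) j := by
  -- The shift by 2 keeps the singleton classes of special positions apart from the two parity
  -- classes.
  let cls : Fin a → ℕ := fun i => if (i : ℕ) < 2 * K then i + 2 else i % 2
  -- Level 0 is the most significant bit; special lines beyond `b` read as `false`.
  let key : Fin a → ℕ := fun i => Nat.ofBits fun l : Fin K =>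
    if h : 2 * (K - 1 - (l : ℕ)) + (i : ℕ) % 2 < b then E i ⟨_, h⟩ else false
  obtain ⟨σ, hσ, hsort⟩ := exists_perm_sorting_classes cls key
  have hpar : ∀ i : Fin a, 2 * K ≤ (i : ℕ) → (σ i : ℕ) % 2 = (i : ℕ) % 2 := by
    intro i hi
    have := hσ i
    simp only [cls] at this
    split_ifs at this <;> omega
  refine ⟨σ, fun i hi => ?_, fun j hj => ?_⟩
  · have := hσ i
    simp only [cls] at this
    apply Fin.ext
    split_ifs at this <;> omega
  · obtain ⟨y, hy⟩ := hdec (j / 2) (by omega)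
      (fun i => i < a ∧ 2 * K ≤ i ∧ i % 2 = j % 2)
      (fun i => if h : i < a then key (σ ⟨i, h⟩) / 2 ^ (K - 1 - j / 2) else 0)
      (by
        rintro i i' ⟨hi, hi2, hi3⟩ ⟨hi', hi2', hi3'⟩ hii'
        rw [dif_pos hi, dif_pos hi']
        refine Nat.div_le_div_right (hsort _ _ hii' ?_)
        simp only [cls]
        rw [if_neg (by omega), if_neg (by omega)]; omega)
      (by
        rintro i ⟨hi, -, -⟩
        rw [dif_pos hi]
        apply Nat.div_lt_of_lt_mul
        rw [← pow_add, show K - 1 - (j : ℕ) / 2 + (j / 2 + 1) = K by omega]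
        exact Nat.ofBits_lt_two_pow _)
    refine ⟨y, fun i hi hij => ?_⟩
    rw [hy i (i.2.trans_le ha) ⟨i.2, hi, hij⟩, dif_pos i.2, ← Nat.testBit_eq_decide_div_mod_eq]
    simp only [key, Fin.eta]
    rw [Nat.testBit_ofBits_lt _ _ (by omega)]
    have h1 : 2 * (K - 1 - (K - 1 - (j : ℕ) / 2)) + (σ i : ℕ) % 2 = j := by
      rw [hpar i hi, hij]; omega
    rw [dif_pos (by dsimp only; rw [h1]; exact j.2)]
    congr 1
    exact Fin.ext h1

/-- The bits of a string, padded by `false`. -/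
def padded {T : ℕ} (x : Fin T → Bool) (s : ℕ) : Bool :=
  if h : s < T then x ⟨s, h⟩ else false

theorem exists_padded_eq {T : ℕ} (e k : ℕ) (he : k ≤ e) (heT : e ≤ T) (y : Fin k → Bool)
    (z : Fin (T - e) → ZMod 2) :
    ∃ x : Fin T → Bool, (∀ s : Fin k, padded x s = y s) ∧
      ∀ s : Fin (T - e), (if padded x (e + s) then (1 : ZMod 2) else 0) = z s := by
  refine ⟨fun s => if h : (s : ℕ) < k then y ⟨s, h⟩ else
    if h : (s : ℕ) - e < T - e then decide (z ⟨s - e, h⟩ = 1) else false, fun s => ?_, fun s => ?_⟩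
  · have := s.2
    rw [padded, dif_pos (by omega), dif_pos s.2]
  · have := s.2
    have h01 : ∀ c : ZMod 2, (if decide (c = 1) = true then (1 : ZMod 2) else 0) = c := by decide
    rw [padded, dif_pos (by omega)]
    dsimp only
    rw [dif_neg (by omega), dif_pos (by omega)]
    simp only [Nat.add_sub_cancel_left]
    exact h01 _

/-- A universal scheme for `a × b` matrices with `a + b = n`, up to permutations of the lines. -/
theorem exists_matrix_scheme (n K : ℕ) (hK : 64 * K ≤ n) (hKn : 5 * K ^ 2 + 2 ≤ n)
    (hp : 2 ^ (K + 11) ≤ 2 * n) (hnp : n ≤ 2 ^ (K + 11)) (hp4 : K + 11 ≤ n / 4)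
    (hq : (1 + (1 / 2 : ℝ) ^ (n / 64)) ^ (2 * n) < 7 / 4) :
    ∃ f : ℕ → Bits (n / 4 + 20 - (K + 11)) → ℕ → Bits (n / 4 + 20 - (K + 11)) → Bool,
      ∀ a b, a + b = n → ∀ E : Fin a → Fin b → Bool,
        ∃ (σ : Equiv.Perm (Fin a)) (τ : Equiv.Perm (Fin b))
          (α : Fin a → Bits (n / 4 + 20 - (K + 11))) (β : Fin b → Bits (n / 4 + 20 - (K + 11))),
          ∀ (i : Fin a) (j : Fin b), f i (α i) j (β j) = E (σ i) (τ j) := by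
  classical
  set p := K + 11 with hpK
  set T := n / 4 + 20 - p with hT
  have hcostT : ∀ i, rowCost p K i ≤ T := by
    intro i
    have h1 := sum_range_level_cost p K (by omega)
    have h2 := rowCost_le p K i
    rw [hpK, show K + 11 - K + 3 = 14 by omega, pow_succ] at h1
    rw [hpK, pow_add] at hp
    rw [hpK] at h2 ⊢
    omega
  let m : Bool × Fin n → ℕ := fun w => T - rowCost p K w.2
  obtain ⟨ω, hω⟩ := exists_universal_coeffs n (fun i j => ¬ SortedCell K i j) m (n / 64) hq
    (fun a b hab R C _ _ hR hC => rectangle_budget n K hK hKn hp hp4 a b hab R C hR hC)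
  obtain ⟨dec, hdec⟩ := exists_isRowDecoder n p K hnp (by omega)
  -- A tag starts with the row code, of length `rowCost`; the rest is the line's part of the
  -- solution of the linear system.
  let row : ℕ → Bits T → ℕ → Bool := fun i x j => dec (i / 2) (fun s => padded x s) j
  let lin : ∀ w : Bool × Fin n, Bits T → Fin n × Fin n → ZMod 2 := fun w x c =>
    ∑ s : Fin (m w), (if padded x (rowCost p K w.2 + s) then (1 : ZMod 2) else 0) * ω w s c
  refine ⟨fun i x j y =>
    if SortedCell K i j then (if j < 2 * K then row j y i else row i x j)
    else if h : i < n ∧ j < n then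
      decide (lin (true, ⟨i, h.1⟩) x (⟨i, h.1⟩, ⟨j, h.2⟩) +
        lin (false, ⟨j, h.2⟩) y (⟨i, h.1⟩, ⟨j, h.2⟩) = 1)
    else false, fun a b hab E => ?_⟩
  obtain ⟨σ, hσ, hσrow⟩ := exists_sorting_perm n p K dec hdec (by omega : a ≤ n) E
  obtain ⟨τ, hτ, hτrow⟩ := exists_sorting_perm n p K dec hdec (by omega : b ≤ n) (fun j i => E i j)
  -- The system is solved for the matrix already permuted.
  obtain ⟨z, hz⟩ := hω a b hab fun i j =>
    if h : (i : ℕ) < a ∧ (j : ℕ) < b then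
      (if E (σ ⟨i, h.1⟩) (τ ⟨j, h.2⟩) then 1 else 0) else 0
  have hα : ∀ i : Fin a, ∃ x : Bits T,
      ((i : ℕ) < 2 * K → ∀ j : Fin b, 2 * K ≤ (j : ℕ) → (j : ℕ) % 2 = (i : ℕ) % 2 →
        row i x j = E i (τ j)) ∧
      ∀ s : Fin (T - rowCost p K i), (if padded x (rowCost p K i + s) then (1 : ZMod 2) else 0) =
        z (true, ⟨i, by omega⟩) s := by
    intro i
    by_cases hi : (i : ℕ) < 2 * K
    · obtain ⟨y, hy⟩ := hτrow i hi
      obtain ⟨x, hx, hx'⟩ := exists_padded_eq (rowCost p K i) _ (by rw [rowCost, if_pos hi])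
        (hcostT i) y (z (true, ⟨i, by omega⟩))
      refine ⟨x, fun _ j hj hij => ?_, hx'⟩
      rw [← hy j hj hij]
      simp only [row, hx]
    · obtain ⟨x, -, hx'⟩ := exists_padded_eq (rowCost p K i) 0 (Nat.zero_le _)
        (hcostT i) Fin.elim0 (z (true, ⟨i, by omega⟩))
      exact ⟨x, fun h => absurd h hi, hx'⟩
  have hβ : ∀ j : Fin b, ∃ x : Bits T,
      ((j : ℕ) < 2 * K → ∀ i : Fin a, 2 * K ≤ (i : ℕ) → (i : ℕ) % 2 = (j : ℕ) % 2 →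
        row j x i = E (σ i) j) ∧
      ∀ s : Fin (T - rowCost p K j), (if padded x (rowCost p K j + s) then (1 : ZMod 2) else 0) =
        z (false, ⟨j, by omega⟩) s := by
    intro j
    by_cases hj : (j : ℕ) < 2 * K
    · obtain ⟨y, hy⟩ := hσrow j hj
      obtain ⟨x, hx, hx'⟩ := exists_padded_eq (rowCost p K j) _ (by rw [rowCost, if_pos hj])
        (hcostT j) y (z (false, ⟨j, by omega⟩))
      refine ⟨x, fun _ i hi hij => ?_, hx'⟩
      rw [← hy i hi hij]
      simp only [row, hx]
    · obtain ⟨x, -, hx'⟩ := exists_padded_eq (rowCost p K j) 0 (Nat.zero_le _)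
        (hcostT j) Fin.elim0 (z (false, ⟨j, by omega⟩))
      exact ⟨x, fun h => absurd h hj, hx'⟩
  choose α hα₁ hα₂ using hα
  choose β hβ₁ hβ₂ using hβ
  refine ⟨σ, τ, α, β, fun i j => ?_⟩
  have hin : (i : ℕ) < n := by omega
  have hjn : (j : ℕ) < n := by omega
  by_cases hs : SortedCell K i j
  · simp only [if_pos hs]
    obtain ⟨hpar, ⟨h1, h2⟩ | ⟨h1, h2⟩⟩ := hs
    · rw [if_neg (by omega), hα₁ i h1 j h2 hpar.symm, hσ i h1]
    · rw [if_pos h1, hβ₁ j h1 i h2 hpar, hτ j h1]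
  · simp only [if_neg hs]
    rw [dif_pos ⟨hin, hjn⟩]
    have e := hz ⟨i, hin⟩ ⟨j, hjn⟩ i.2 j.2 hs
    rw [dif_pos ⟨i.2, j.2⟩] at e
    have e1 : lin (true, ⟨i, hin⟩) (α i) (⟨i, hin⟩, ⟨j, hjn⟩) +
        lin (false, ⟨j, hjn⟩) (β j) (⟨i, hin⟩, ⟨j, hjn⟩) =
        if E (σ i) (τ j) then 1 else 0 := by
      rw [← e]
      congr 1
      · exact sum_congr rfl fun s _ => by rw [← hα₂ i s]
      · exact sum_congr rfl fun s _ => by rw [← hβ₂ j s]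
    rw [e1]
    cases E (σ i) (τ j) <;> simp

/-- With p = ⌈lg n⌉, so that 2^(p-1) < n, this yields the lower bounds on n in terms of K that the
scheme needs. -/
theorem quadratic_le_two_pow (p : ℕ) (hp : 20 ≤ p) : 5 * p ^ 2 + 64 * p + 200 ≤ 2 ^ (p - 1) := by
  induction p, hp using Nat.le_induction with
  | base => norm_num
  | succ p hp ih =>
    have h : 2 ^ (p + 1 - 1) = 2 * 2 ^ (p - 1) := by
      rw [← pow_succ']; congr 1; omega
    rw [h]
    nlinarith

theorem one_add_half_pow_lt {n q : ℕ} (h : 4 * n ≤ 2 ^ q) :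
    (1 + (1 / 2 : ℝ) ^ q) ^ (2 * n) < 7 / 4 := by
  set x : ℝ := (1 / 2) ^ q with hx
  have hx0 : 0 < x := by positivity
  have h1 : x * (4 * n) ≤ 1 := by
    have h' : (4 * n : ℝ) ≤ 2 ^ q := by exact_mod_cast h
    calc x * (4 * n) ≤ x * 2 ^ q := by gcongr
      _ = 1 := by rw [hx, ← mul_pow]; norm_num
  have h2 : (1 + x) ^ (2 * n) ≤ Real.exp (1 / 2) :=
    calc (1 + x) ^ (2 * n) ≤ Real.exp x ^ (2 * n) := by
          gcongr; rw [add_comm]; exact Real.add_one_le_exp x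
      _ = Real.exp ((2 * n : ℕ) * x) := by rw [← Real.exp_nat_mul]
      _ ≤ Real.exp (1 / 2) := Real.exp_le_exp.2 (by push_cast; linarith)
  have h3 : Real.exp (1 / 2) ^ 2 < (7 / 4) ^ 2 := by
    rw [← Real.exp_nat_mul]
    norm_num
    exact Real.exp_one_lt_d9.trans (by norm_num)
  exact h2.trans_lt (lt_of_pow_lt_pow_left₀ 2 (by norm_num) h3)

/-! ### From matrices to labels of bipartite graphs -/

theorem ofBits_binaryEncoding {n b i : ℕ} (hn : n ≤ 2 ^ b) (hi : i < n) :
    Nat.ofBits (binaryEncoding b i) = i := by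
  unfold binaryEncoding
  rw [Nat.ofBits_testBit, Nat.mod_eq_of_lt (hi.trans_le hn)]

/-- Packs an index and a tag into one label. -/
theorem exists_labelingScheme_of_index_tag {n t : ℕ} (F : Set (SimpleGraph (Fin n)))
    (core : ℕ → Bits t → ℕ → Bits t → Bool) (hcomm : ∀ i x j y, core i x j y = core j y i x)
    (h : ∀ G : F, ∃ (ind : Fin n → Fin n) (tag : Fin n → Bits t), Function.Injective ind ∧
      ∀ u v, (G : SimpleGraph (Fin n)).Adj u v ↔ core (ind u) (tag u) (ind v) (tag v) = true) :
    ∃ (S : AdjacencyLabelingScheme F (Nat.clog 2 n + t)) (ind : F → Fin n → Fin n)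
      (tag : F → Fin n → Bits t), (∀ G : F, Function.Injective (ind G)) ∧
      ∀ (G : F) (u : Fin n),
        S.label G u = Fin.append (binaryEncoding (Nat.clog 2 n) (ind G u : ℕ)) (tag G u) := by
  choose ind tag hind hadj using h
  refine ⟨⟨fun G u => Fin.append (binaryEncoding (Nat.clog 2 n) (ind G u : ℕ)) (tag G u),
    fun x y => core (Nat.ofBits fun i => x (Fin.castAdd t i)) (fun i => x (Fin.natAdd _ i))
      (Nat.ofBits fun i => y (Fin.castAdd t i)) (fun i => y (Fin.natAdd _ i)),
    fun x y => hcomm _ _ _ _, fun G u v => ?_⟩, ind, tag, hind, fun _ _ => rfl⟩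
  have hn : n ≤ 2 ^ Nat.clog 2 n := Nat.le_pow_clog (by norm_num) n
  simp only [Fin.append_left, Fin.append_right]
  rw [hadj, ofBits_binaryEncoding hn (ind G u).2, ofBits_binaryEncoding hn (ind G v).2]

theorem exists_full_row_core (n : ℕ) : ∃ core : ℕ → Bits n → ℕ → Bits n → Bool,
    (∀ i x j y, core i x j y = core j y i x) ∧
      ∀ G : SimpleGraph (Fin n), ∃ (ind : Fin n → Fin n) (tag : Fin n → Bits n),
        Function.Injective ind ∧
          ∀ u v, G.Adj u v ↔ core (ind u) (tag u) (ind v) (tag v) = true := by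
  classical
  refine ⟨fun i x j y => padded x j && padded y i, fun i x j y => Bool.and_comm _ _, fun G =>
    ⟨id, fun u v => decide (G.Adj u v), Function.injective_id, fun u v => ?_⟩⟩
  simp [padded, G.adj_comm v u]

/-- Turns a scheme for matrices into one for bipartite graphs: one side is indexed from below, the
other from above, and one more bit tells the sides apart. -/
theorem exists_bipartite_core {n T : ℕ} (f : ℕ → Bits T → ℕ → Bits T → Bool)
    (hf : ∀ a b, a + b = n → ∀ E : Fin a → Fin b → Bool,
      ∃ (σ : Equiv.Perm (Fin a)) (τ : Equiv.Perm (Fin b)) (α : Fin a → Bits T)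
        (β : Fin b → Bits T),
        ∀ (i : Fin a) (j : Fin b), f i (α i) j (β j) = E (σ i) (τ j)) :
    ∃ core : ℕ → Bits (T + 1) → ℕ → Bits (T + 1) → Bool,
      (∀ i x j y, core i x j y = core j y i x) ∧
        ∀ G ∈ bipartiteGraphs n, ∃ (ind : Fin n → Fin n) (tag : Fin n → Bits (T + 1)),
          Function.Injective ind ∧
            ∀ u v, G.Adj u v ↔ core (ind u) (tag u) (ind v) (tag v) = true := by
  classical
  refine ⟨fun i x j y => match x 0, y 0 with
    | true, false => f i (Fin.tail x) (n - 1 - j) (Fin.tail y)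
    | false, true => f j (Fin.tail y) (n - 1 - i) (Fin.tail x)
    | _, _ => false, ?_, fun G hG => ?_⟩
  · intro i x j y
    cases hx : x 0 <;> cases hy : y 0 <;> simp [hx, hy]
  obtain ⟨c⟩ : G.Colorable 2 := hG
  let P : Fin n → Prop := fun v => c v = 0
  have hcard : Fintype.card {v // P v} + Fintype.card {v // ¬ P v} = n := by
    rw [← Fintype.card_sum, Fintype.card_congr (Equiv.sumCompl P), Fintype.card_fin]
  let eA := Fintype.equivFin {v // P v}
  let eB := Fintype.equivFin {v // ¬ P v}
  obtain ⟨σ, τ, α, β, hE⟩ := hf _ _ hcard fun i j => decide (G.Adj (eA.symm i) (eB.symm j))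
  let posA : {v // P v} → Fin (Fintype.card {v // P v}) := fun v => σ.symm (eA v)
  let posB : {v // ¬ P v} → Fin (Fintype.card {v // ¬ P v}) := fun v => τ.symm (eB v)
  have hposA : Function.Injective posA := σ.symm.injective.comp eA.injective
  have hposB : Function.Injective posB := τ.symm.injective.comp eB.injective
  have key : ∀ u v, f (posA u) (α (posA u)) (posB v) (β (posB v)) = decide (G.Adj u v) := by
    intro u v
    rw [hE]
    simp [posA, posB]
  let ind : Fin n → Fin n := fun u =>
    if h : P u then ⟨posA ⟨u, h⟩, by omega⟩ else ⟨n - 1 - posB ⟨u, h⟩, by omega⟩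
  let tag : Fin n → Bits (T + 1) := fun u =>
    if h : P u then Fin.cons true (α (posA ⟨u, h⟩)) else Fin.cons false (β (posB ⟨u, h⟩))
  have indA : ∀ u (h : P u), (ind u : ℕ) = posA ⟨u, h⟩ := fun u h => by simp [ind, h]
  have indB : ∀ u (h : ¬ P u), (ind u : ℕ) = n - 1 - posB ⟨u, h⟩ := fun u h => by simp [ind, h]
  have tagA : ∀ u (h : P u), tag u = Fin.cons true (α (posA ⟨u, h⟩)) := fun u h => by
    simp [tag, h]
  have tagB : ∀ u (h : ¬ P u), tag u = Fin.cons false (β (posB ⟨u, h⟩)) := fun u h => by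
    simp [tag, h]
  refine ⟨ind, tag, fun u v huv => ?_, fun u v => ?_⟩
  · have huv' : (ind u : ℕ) = ind v := by rw [huv]
    by_cases hu : P u <;> by_cases hv : P v
    · rw [indA u hu, indA v hv] at huv'
      exact congrArg Subtype.val (hposA (Fin.ext huv'))
    -- With a vertices on the first side, its indices are below a, those of the other side at least
    -- a.
    · rw [indA u hu, indB v hv] at huv'
      have := (posA ⟨u, hu⟩).2
      have := (posB ⟨v, hv⟩).2
      omega
    · rw [indB u hu, indA v hv] at huv'
      have := (posA ⟨v, hv⟩).2
      have := (posB ⟨u, hu⟩).2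
      omega
    · rw [indB u hu, indB v hv] at huv'
      have h1 := (posB ⟨u, hu⟩).2
      have h2 := (posB ⟨v, hv⟩).2
      have h3 : (posB ⟨u, hu⟩ : ℕ) = posB ⟨v, hv⟩ := by omega
      exact congrArg Subtype.val (hposB (Fin.ext h3))
  · have hback : ∀ v (h : ¬ P v), n - 1 - (n - 1 - (posB ⟨v, h⟩ : ℕ)) = posB ⟨v, h⟩ := by
      intro v h
      have := (posB ⟨v, h⟩).2
      omega
    by_cases hu : P u <;> by_cases hv : P v
    · rw [tagA u hu, tagA v hv]
      simp only [Fin.cons_zero, Bool.false_eq_true, iff_false]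
      exact fun h => c.valid h (hu.trans hv.symm)
    · rw [tagA u hu, tagB v hv, indA u hu, indB v hv]
      simp only [Fin.cons_zero, Fin.tail_cons, hback, key, decide_eq_true_eq]
    · rw [tagB u hu, tagA v hv, indB u hu, indA v hv]
      simp only [Fin.cons_zero, Fin.tail_cons, hback, key, decide_eq_true_eq]
      exact G.adj_comm u v
    · rw [tagB u hu, tagB v hv]
      simp only [Fin.cons_zero, Bool.false_eq_true, iff_false]
      intro h
      have h0 : ∀ d : Fin 2, d ≠ 0 → d = 1 := by decide
      exact c.valid h ((h0 _ hu).trans (h0 _ hv).symm)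

end

/-! ### Choice of parameters -/

theorem mainTheorem6 :
    ∃ C : ℝ, ∀ n : ℕ, 1 ≤ n →
      ∃ t : ℕ,
        |(t : ℝ) - ((n : ℝ) / 4 - Real.logb 2 (n : ℝ))| ≤ C ∧
        |((Nat.clog 2 n + t : ℕ) : ℝ) - (n : ℝ) / 4| ≤ C ∧
        ∃ (S : AdjacencyLabelingScheme (bipartiteGraphs n) (Nat.clog 2 n + t))
          (ind : bipartiteGraphs n → Fin n → Fin n)
          (tag : bipartiteGraphs n → Fin n → Bits t),
          (∀ G : bipartiteGraphs n, Function.Injective (ind G)) ∧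
          ∀ (G : bipartiteGraphs n) (u : Fin n),
            S.label G u =
              Fin.append (binaryEncoding (Nat.clog 2 n) (ind G u : ℕ)) (tag G u) := by
  refine ⟨2 ^ 22, fun n hn => ?_⟩
  have hn1 : (1 : ℝ) ≤ n := by exact_mod_cast hn
  have hlog0 : 0 ≤ Real.logb 2 n := Real.logb_nonneg (by norm_num) hn1
  have hceil : ⌈Real.logb 2 n⌉₊ = Nat.clog 2 n := by
    exact_mod_cast Real.natCeil_logb_natCast 2 n
  have hclog1 : Real.logb 2 n ≤ Nat.clog 2 n := hceil ▸ Nat.le_ceil _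
  have hclog2 : (Nat.clog 2 n : ℝ) < Real.logb 2 n + 1 := hceil ▸ Nat.ceil_lt_add_one hlog0
  -- Small n are absorbed by the constant: the tag is the whole adjacency row.
  rcases lt_or_ge n (2 ^ 20) with hsmall | hlarge
  · have hp : Nat.clog 2 n ≤ 20 := Nat.clog_le_of_le_pow hsmall.le
    have hp' : (Nat.clog 2 n : ℝ) ≤ 20 := by exact_mod_cast hp
    have hn' : (n : ℝ) < 2 ^ 20 := by exact_mod_cast hsmall
    obtain ⟨core, hcomm, hcore⟩ := exists_full_row_core n
    refine ⟨n, ?_, ?_, exists_labelingScheme_of_index_tag _ core hcomm fun G => hcore G⟩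
    · rw [abs_le]; constructor <;> linarith
    · push_cast
      rw [abs_le]; constructor <;> linarith
  · have hpn : n ≤ 2 ^ Nat.clog 2 n := Nat.le_pow_clog (by norm_num) n
    have hpl : 2 ^ (Nat.clog 2 n - 1) < n := Nat.pow_pred_clog_lt_self (by norm_num) (by omega)
    have hp20 : 20 ≤ Nat.clog 2 n := by
      by_contra h
      have : 2 ^ Nat.clog 2 n ≤ 2 ^ 19 := Nat.pow_le_pow_right (by norm_num) (by omega)
      omega
    obtain ⟨K, hK⟩ : ∃ K, Nat.clog 2 n = K + 11 := ⟨Nat.clog 2 n - 11, by omega⟩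
    have hquad := quadratic_le_two_pow _ hp20
    rw [hK] at hquad hpn hpl
    have h2 : 2 ^ (K + 11) = 2 * 2 ^ (K + 11 - 1) := by
      rw [show K + 11 - 1 = K + 10 by omega]; ring
    have hsq : 5 * (K + 11) ^ 2 = 5 * K ^ 2 + 110 * K + 605 := by ring
    have hq : 4 * n ≤ 2 ^ (n / 64) :=
      calc 4 * n ≤ 4 * 2 ^ (K + 11) := by omega
        _ = 2 ^ (K + 13) := by ring
        _ ≤ 2 ^ (n / 64) := Nat.pow_le_pow_right (by norm_num) (by omega)
    obtain ⟨f, hf⟩ := exists_matrix_scheme n K (by omega) (by omega) (by omega) hpn (by omega)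
      (one_add_half_pow_lt hq)
    obtain ⟨core, hcomm, hcore⟩ := exists_bipartite_core f hf
    -- The last bit names the side; with K + 11 index bits the label has ⌊n/4⌋ + 21 bits.
    refine ⟨n / 4 + 20 - (K + 11) + 1, ?_, ?_,
      exists_labelingScheme_of_index_tag _ core hcomm fun G => hcore G G.2⟩
    · obtain ⟨t, ht⟩ : ∃ t, n / 4 + 20 - (K + 11) + 1 = t := ⟨_, rfl⟩
      have h3 : 4 * (t + (K + 11)) ≤ n + 84 := by omega
      have h4 : n + 80 ≤ 4 * (t + (K + 11)) := by omega
      have h3' : (4 * (t + (K + 11)) : ℝ) ≤ n + 84 := by exact_mod_cast h3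
      have h4' : (n + 80 : ℝ) ≤ 4 * (t + (K + 11)) := by exact_mod_cast h4
      rw [hK] at hclog1 hclog2
      push_cast at hclog1 hclog2
      rw [ht, abs_le]; constructor <;> linarith
    · rw [hK]
      obtain ⟨t, ht⟩ : ∃ t, K + 11 + (n / 4 + 20 - (K + 11) + 1) = t := ⟨_, rfl⟩
      have h3 : 4 * t ≤ n + 84 := by omega
      have h4 : n + 80 ≤ 4 * t := by omega
      have h3' : (4 * t : ℝ) ≤ n + 84 := by exact_mod_cast h3
      have h4' : (n + 80 : ℝ) ≤ 4 * t := by exact_mod_cast h4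
      rw [ht, abs_le]; constructor <;> linarith
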